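/- Let $\Omega_n$ be the set of $n\times n$ density matrices (positive semidefinite complex matrices of trace one). For $\rho^A,\rho^B\in\Omega_n$ let $\Gamma^Q(\rho^A,\rho^B)$ be the set of density matrices $\rho^{AB}$ on $\mathbb{C}^n\otimes\mathbb{C}^n$ with partial traces $\operatorname{tr}_B\rho^{AB}=\rho^A$ and $\operatorname{tr}_A\rho^{AB}=\rho^B$, and for a Hermitian operator $C$ on $\mathbb{C}^n\otimes\mathbb{C}^n$ put $$\mathrm{T}^Q_C(\rho^A,\rho^B)=\min_{\rho^{AB}\in\Gamma^Q(\rho^A,\rho^B)}\operatorname{tr}(C\rho^{AB}).$$ Let $C^Q=\tfrac12(\mathbb{I}-S)$, where $S$ is the SWAP operator $\mathbf{x}\otimes\mathbf{y}\mapsto\mathbf{y}\otimes\mathbf{x}$. For $C$ positive semidefinite whose kernel is exactly the space of symmetric tensors, the quantum Wasserstein-2 distance on $\Omega_n$ is $$\mathrm{W}^Q_C(\rho^A,\rho^B)=\lim_{N\to\infty}\ \inf_{\substack{\rho_1,\dots,\rho_N\in\Omega_n\\ \rho_0=\rho^A,\ \rho_{N+1}=\rho^B}}\ \sum_{i=0}^{N}\sqrt{\mathrm{T}^Q_C(\rho_i,\rho_{i+1})}.$$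 **Corollary.** Let $n=2$. The minimum defining $\mathrm{T}^Q_{C^Q}$ is attained and nonnegative on $\Omega_2\times\Omega_2$, and $\sqrt{\mathrm{T}^Q_{C^Q}}$ is a metric on the set $\Omega_2$ of qubit states: it is nonnegative, symmetric, vanishes exactly when the two states coincide, and satisfies the triangle inequality. Moreover $C^Q$ is positive semidefinite and its kernel is exactly the space of symmetric tensors, the infimum over chains is attained for each $N$, the limit as $N\to\infty$ exists, and $$\mathrm{W}^Q_{C^Q}(\rho^A,\rho^B)=\sqrt{\mathrm{T}^Q_{C^Q}(\rho^A,\rho^B)}\qquad\text{for all }\rho^A,\rho^B\in\Omega_2.$$ -/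

import Mathlib

open scoped ComplexOrder

namespace QOT

/-- A density matrix: a positive semidefinite (hence Hermitian) complex matrix of trace one. -/
def IsDensity {ι : Type*} [Fintype ι] (ρ : Matrix ι ι ℂ) : Prop :=
  ρ.PosSemidef ∧ ρ.trace = 1

/-- `Density n` is the set `Ω_n` of `n × n` density matrices. -/
abbrev Density (n : ℕ) : Type :=
  {ρ : Matrix (Fin n) (Fin n) ℂ // IsDensity ρ}

/-- The partial trace over the first factor. -/
def trA {m n : ℕ} (R : Matrix (Fin m × Fin n) (Fin m × Fin n) ℂ) : Matrix (Fin n) (Fin n) ℂ :=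
  Matrix.of fun p q => ∑ i, R (i, p) (i, q)

/-- The partial trace over the second factor. -/
def trB {m n : ℕ} (R : Matrix (Fin m × Fin n) (Fin m × Fin n) ℂ) : Matrix (Fin m) (Fin m) ℂ :=
  Matrix.of fun i j => ∑ p, R (i, p) (j, p)

/-- The set `Γ^Q(ρA, ρB)` of quantum couplings. -/
def couplings {m n : ℕ} (ρA : Density m) (ρB : Density n) :
    Set (Matrix (Fin m × Fin n) (Fin m × Fin n) ℂ) :=
  {R | IsDensity R ∧ trB R = ρA.1 ∧ trA R = ρB.1}

/-- The costs `tr (C R)` of the couplings `R`. For Hermitian `C` these traces are real. -/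
def costs {m n : ℕ} (C : Matrix (Fin m × Fin n) (Fin m × Fin n) ℂ)
    (ρA : Density m) (ρB : Density n) : Set ℝ :=
  (fun R => (C * R).trace.re) '' couplings ρA ρB

/-- The quantum optimal transport cost `T^Q_C(ρA, ρB)`, the minimum of `costs C ρA ρB`. -/
noncomputable def transport {m n : ℕ} (C : Matrix (Fin m × Fin n) (Fin m × Fin n) ℂ)
    (ρA : Density m) (ρB : Density n) : ℝ :=
  sInf (costs C ρA ρB)

/-- The SWAP operator `x ⊗ y ↦ y ⊗ x` on `ℂⁿ ⊗ ℂⁿ`. -/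
def swap (n : ℕ) : Matrix (Fin n × Fin n) (Fin n × Fin n) ℂ :=
  Matrix.of fun a b => if a = b.swap then 1 else 0

/-- The cost matrix `C^Q = (I - S) / 2`. -/
noncomputable def swapCost (n : ℕ) : Matrix (Fin n × Fin n) (Fin n × Fin n) ℂ :=
  (1 / 2 : ℂ) • (1 - swap n)

/-- The kernel of `C` is the space of symmetric matrices, where `ℂⁿ ⊗ ℂⁿ` is identified with the
space of `n × n` matrices. -/
def VanishesExactlyOnSymmetric {n : ℕ} (C : Matrix (Fin n × Fin n) (Fin n × Fin n) ℂ) : Prop :=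
  ∀ X : Fin n × Fin n → ℂ, C.mulVec X = 0 ↔ ∀ i j, X (i, j) = X (j, i)

/-- `D` is a metric on `X`. -/
structure IsMetric {X : Type*} (D : X → X → ℝ) : Prop where
  nonneg : ∀ x y, 0 ≤ D x y
  eq_zero_iff : ∀ x y, D x y = 0 ↔ x = y
  symm : ∀ x y, D x y = D y x
  triangle : ∀ x y z, D x z ≤ D x y + D y z

/-- The `D`-lengths of the chains from `x` to `y` with `N` intermediate points. -/
def chainLengths {X : Type*} (D : X → X → ℝ) (N : ℕ) (x y : X) : Set ℝ :=
  {L | ∃ z : Fin (N + 2) → X, z 0 = x ∧ z (Fin.last (N + 1)) = y ∧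
    L = ∑ i : Fin (N + 1), D (z i.castSucc) (z i.succ)}

/-- The function `D_N`, the least length of a chain with `N` intermediate points. -/
noncomputable def chainDist {X : Type*} (D : X → X → ℝ) (N : ℕ) (x y : X) : ℝ :=
  sInf (chainLengths D N x y)

/-- The induced metric `D_∞ = lim D_N`. -/
noncomputable def inducedDist {X : Type*} (D : X → X → ℝ) (x y : X) : ℝ :=
  Filter.limUnder Filter.atTop fun N => chainDist D N x y

/-- The square root of the quantum optimal transport cost on `Ω_n`. -/
noncomputable def sqrtTransport {n : ℕ} (C : Matrix (Fin n × Fin n) (Fin n × Fin n) ℂ)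
    (ρA ρB : Density n) : ℝ :=
  √(transport C ρA ρB)

/-- The quantum Wasserstein-2 distance `W^Q_C`, for positive semidefinite `C` vanishing exactly on
symmetric matrices. -/
noncomputable def wasserstein {n : ℕ} (C : Matrix (Fin n × Fin n) (Fin n × Fin n) ℂ)
    (ρA ρB : Density n) : ℝ :=
  inducedDist (sqrtTransport C) ρA ρB

end QOT

/-! For qubits the cost has a dual form: `T(ρA, ρB)` is half the maximum over unit vectors `u` of
`(√⟨u, ρA u⟩ - √⟨u, ρB u⟩)²`. So `√T` is a supremum of pseudometrics: symmetry and the triangle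
inequality follow by testing at one maximising `u`, and states are separated because a Hermitian
form determines its matrix. For a metric no chain beats the direct step, so every `D_N`, and hence
the limit, equals `√T`.

For the dual form, `U ⊗ U` commutes with the swap, so `u` may be rotated to `e₀`. That no coupling
costs less is Cauchy–Schwarz on its entries (`sq_sub_sqrt_le_of_mem_costs`). Conversely let `u = e₀`
be a maximiser and let `t²` be the ratio of the `(0,0)` entries. Outside degenerate cases,
maximality forces the off-diagonal entries to have ratio `t` and a certain 2×2 matrix to be
positive, and that matrix yields a coupling of the required cost (`mem_costs_of_isMax`,
`mem_costs_of_posSemidef`). -/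

namespace QOT

open Matrix Kronecker

/-! ### Chains in a metric -/

section Chains

variable {X : Type*} {D : X → X → ℝ}

theorem IsMetric.le_chain (hD : IsMetric D) :
    ∀ (N : ℕ) (z : Fin (N + 2) → X),
      D (z 0) (z (Fin.last (N + 1))) ≤ ∑ i : Fin (N + 1), D (z i.castSucc) (z i.succ) := by
  intro N
  induction N with
  | zero => intro z; simp
  | succ N ih =>
    intro z
    rw [Fin.sum_univ_castSucc]
    have h := ih fun i => z i.castSucc
    have h' := hD.triangle (z 0) (z (Fin.last (N + 1)).castSucc) (z (Fin.last (N + 2)))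
    simp only [Fin.castSucc_zero, Fin.succ_castSucc, Fin.succ_last] at h h' ⊢
    linarith

theorem IsMetric.isLeast_chainLengths (hD : IsMetric D) (N : ℕ) (x y : X) :
    IsLeast (chainLengths D N x y) (D x y) := by
  -- The optimal chain jumps to `y` at once and stays there.
  refine ⟨⟨Fin.cons x fun _ => y, by simp, ?_, ?_⟩, ?_⟩
  · rw [← Fin.succ_last, Fin.cons_succ]
  · have hy : D y y = 0 := (hD.eq_zero_iff y y).2 rfl
    rw [Fin.sum_univ_succ]
    simp [hy]
  · rintro L ⟨z, rfl, rfl, rfl⟩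
    exact hD.le_chain N z

theorem IsMetric.chainDist_eq (hD : IsMetric D) (N : ℕ) (x y : X) : chainDist D N x y = D x y :=
  (hD.isLeast_chainLengths N x y).csInf_eq

theorem IsMetric.inducedDist_eq (hD : IsMetric D) (x y : X) : inducedDist D x y = D x y := by
  simp only [inducedDist, hD.chainDist_eq]
  exact tendsto_const_nhds.limUnder_eq

end Chains

/-! ### The swap cost on any dimension -/

section SwapCost

variable {n : ℕ}

theorem swapCost_mulVec (X : Fin n × Fin n → ℂ) (a : Fin n × Fin n) :
    (swapCost n).mulVec X a = (X a - X a.swap) / 2 := by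
  have h : (swap n).mulVec X a = X a.swap := by
    simp only [swap, mulVec, dotProduct, of_apply, ite_mul, one_mul, zero_mul]
    rw [Finset.sum_eq_single a.swap] <;> aesop
  simp only [swapCost, smul_mulVec, sub_mulVec, one_mulVec, Pi.smul_apply, Pi.sub_apply, h,
    smul_eq_mul]
  ring

theorem swap_mul_apply (R : Matrix (Fin n × Fin n) (Fin n × Fin n) ℂ) (a b : Fin n × Fin n) :
    (swap n * R) a b = R a.swap b := by
  simp only [swap, mul_apply, of_apply, ite_mul, one_mul, zero_mul]
  rw [Finset.sum_eq_single a.swap] <;> aesop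

theorem mul_swap_apply (R : Matrix (Fin n × Fin n) (Fin n × Fin n) ℂ) (a b : Fin n × Fin n) :
    (R * swap n) a b = R a b.swap := by
  simp [swap, mul_apply]

theorem swap_mul_swap : swap n * swap n = 1 := by
  ext a b
  rw [swap_mul_apply]
  simp [swap, one_apply, Prod.swap_inj]

theorem swap_conjTranspose : (swap n)ᴴ = swap n := by
  ext a b
  simp only [swap, conjTranspose_apply, of_apply, apply_ite star, star_one, star_zero]
  congr 1
  rw [eq_iff_iff]
  constructor <;> rintro rfl <;> simp

/-- The swap is a Hermitian involution, so `C^Q` is an orthogonal projection. -/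
theorem swapCost_posSemidef : (swapCost n).PosSemidef := by
  have h : swapCost n = (swapCost n)ᴴ * swapCost n := by
    have h' : (1 - swap n) * (1 - swap n) = (2 : ℂ) • (1 - swap n) := by
      rw [sub_mul, mul_sub, mul_sub, swap_mul_swap, two_smul]
      simp only [mul_one, one_mul]
      abel
    simp only [swapCost, conjTranspose_smul, conjTranspose_sub, conjTranspose_one,
      swap_conjTranspose, smul_mul_smul_comm, h', smul_smul]
    congr 1
    simp
  rw [h]
  exact posSemidef_conjTranspose_mul_self _

theorem swapCost_vanishesExactlyOnSymmetric : VanishesExactlyOnSymmetric (swapCost n) := by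
  intro X
  rw [funext_iff]
  simp [swapCost_mulVec, sub_eq_zero]

theorem swapCost_mul_trace (R : Matrix (Fin n × Fin n) (Fin n × Fin n) ℂ) :
    (swapCost n * R).trace = (1 / 2 : ℂ) * (R.trace - ∑ a, R a.swap a) := by
  simp [swapCost, trace, sub_mul, swap_mul_apply, ← Finset.mul_sum]

end SwapCost

/-! ### Invariance under simultaneous rotation -/

section UnitaryInvariance

variable {n : ℕ}

/-- The partial trace is dual to `X ↦ X ⊗ 1`; its behaviour under conjugation then follows from
cyclicity of the trace. -/
theorem trace_trB_mul (R : Matrix (Fin n × Fin n) (Fin n × Fin n) ℂ)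
    (X : Matrix (Fin n) (Fin n) ℂ) : (trB R * X).trace = (R * (X ⊗ₖ 1)).trace := by
  simp only [trace, diag, mul_apply, trB, of_apply, Fintype.sum_prod_type, kroneckerMap_apply,
    one_apply, mul_ite, mul_one, mul_zero, Finset.sum_ite_eq', Finset.mem_univ, if_true,
    Finset.sum_mul]
  refine Finset.sum_congr rfl fun i _ => ?_
  rw [Finset.sum_comm]

theorem trace_trA_mul (R : Matrix (Fin n × Fin n) (Fin n × Fin n) ℂ)
    (X : Matrix (Fin n) (Fin n) ℂ) : (trA R * X).trace = (R * (1 ⊗ₖ X)).trace := by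
  simp only [trace, diag, mul_apply, trA, of_apply, Fintype.sum_prod_type, kroneckerMap_apply,
    one_apply, ite_mul, one_mul, zero_mul, mul_ite, mul_zero, Finset.sum_mul]
  rw [Finset.sum_comm]
  conv_lhs => enter [2, q]; rw [Finset.sum_comm]
  rw [Finset.sum_comm]
  refine Finset.sum_congr rfl fun i _ => ?_
  rw [Finset.sum_comm]
  refine Finset.sum_congr rfl fun p _ => ?_
  rw [Finset.sum_comm]
  simp

theorem eq_of_trace_mul_eq {A B : Matrix (Fin n) (Fin n) ℂ}
    (h : ∀ X, (A * X).trace = (B * X).trace) : A = B := by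
  ext i j
  simpa [trace_mul_single] using h (single j i 1)

variable {U : Matrix (Fin n) (Fin n) ℂ}

theorem trB_conj (hU : Uᴴ * U = 1) (R : Matrix (Fin n × Fin n) (Fin n × Fin n) ℂ) :
    trB ((U ⊗ₖ U) * R * (U ⊗ₖ U)ᴴ) = U * trB R * Uᴴ := by
  refine eq_of_trace_mul_eq fun X => ?_
  rw [trace_trB_mul, mul_assoc, mul_assoc, trace_mul_comm, mul_assoc U, mul_assoc U,
    trace_mul_comm U, mul_assoc (trB R), mul_assoc (trB R), trace_trB_mul,
    conjTranspose_kronecker, mul_assoc, ← mul_kronecker_mul, mul_assoc, ← mul_kronecker_mul]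
  simp [hU, mul_assoc]

theorem trA_conj (hU : Uᴴ * U = 1) (R : Matrix (Fin n × Fin n) (Fin n × Fin n) ℂ) :
    trA ((U ⊗ₖ U) * R * (U ⊗ₖ U)ᴴ) = U * trA R * Uᴴ := by
  refine eq_of_trace_mul_eq fun X => ?_
  rw [trace_trA_mul, mul_assoc, mul_assoc, trace_mul_comm, mul_assoc U, mul_assoc U,
    trace_mul_comm U, mul_assoc (trA R), mul_assoc (trA R), trace_trA_mul,
    conjTranspose_kronecker, mul_assoc, ← mul_kronecker_mul, mul_assoc, ← mul_kronecker_mul]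
  simp [hU, mul_assoc]

theorem swapCost_mul_kronecker_self (U : Matrix (Fin n) (Fin n) ℂ) :
    swapCost n * (U ⊗ₖ U) = (U ⊗ₖ U) * swapCost n := by
  have h : swap n * (U ⊗ₖ U) = (U ⊗ₖ U) * swap n := by
    ext a b
    rw [swap_mul_apply, mul_swap_apply]
    simp [mul_comm]
  simp [swapCost, sub_mul, mul_sub, h]

theorem IsDensity.conj {ι : Type*} [Fintype ι] [DecidableEq ι] {V ρ : Matrix ι ι ℂ}
    (hρ : IsDensity ρ) (hV : Vᴴ * V = 1) : IsDensity (V * ρ * Vᴴ) :=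
  ⟨hρ.1.mul_mul_conjTranspose_same V, by
    rw [trace_mul_comm, ← mul_assoc, hV, one_mul, hρ.2]⟩

/-- The state `U ρ Uᴴ`. -/
def Density.conj (ρ : Density n) (hU : Uᴴ * U = 1) : Density n :=
  ⟨U * ρ.1 * Uᴴ, ρ.2.conj hU⟩

theorem costs_subset_costs_conj (ρA ρB : Density n) (hU : Uᴴ * U = 1) :
    costs (swapCost n) ρA ρB ⊆ costs (swapCost n) (ρA.conj hU) (ρB.conj hU) := by
  rintro _ ⟨R, ⟨hR, hA, hB⟩, rfl⟩
  have hUU : (U ⊗ₖ U)ᴴ * (U ⊗ₖ U) = 1 := by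
    rw [conjTranspose_kronecker, ← mul_kronecker_mul, hU, one_kronecker_one]
  refine ⟨(U ⊗ₖ U) * R * (U ⊗ₖ U)ᴴ, ⟨hR.conj hUU, ?_, ?_⟩, ?_⟩
  · rw [trB_conj hU, hA]; rfl
  · rw [trA_conj hU, hB]; rfl
  · dsimp only
    rw [← mul_assoc, ← mul_assoc, swapCost_mul_kronecker_self, trace_mul_comm, ← mul_assoc,
      ← mul_assoc, hUU, one_mul]

theorem costs_conj (ρA ρB : Density n) (hU : Uᴴ * U = 1) :
    costs (swapCost n) (ρA.conj hU) (ρB.conj hU) = costs (swapCost n) ρA ρB := by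
  refine Set.Subset.antisymm ?_ (costs_subset_costs_conj ρA ρB hU)
  have hU' : Uᴴᴴ * Uᴴ = 1 := by rw [conjTranspose_conjTranspose, mul_eq_one_comm.1 hU]
  have h : ∀ ρ : Density n, (ρ.conj hU).conj hU' = ρ := by
    intro ρ
    apply Subtype.ext
    simp only [Density.conj, conjTranspose_conjTranspose]
    rw [mul_assoc, mul_assoc, hU, mul_one, ← mul_assoc, hU, one_mul]
  simpa only [h] using costs_subset_costs_conj (ρA.conj hU) (ρB.conj hU) hU'

end UnitaryInvariance

/-! ### Quadratic forms and qubit states -/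

/-- The real part of `⟨x, ρ x⟩`. -/
def quadForm {ι : Type*} [Fintype ι] (ρ : Matrix ι ι ℂ) (x : ι → ℂ) : ℝ :=
  (star x ⬝ᵥ ρ *ᵥ x).re

section QuadForm

variable {ι : Type*} [Fintype ι]

theorem quadForm_nonneg {ρ : Matrix ι ι ℂ} (hρ : ρ.PosSemidef) (x : ι → ℂ) : 0 ≤ quadForm ρ x :=
  hρ.re_dotProduct_nonneg x

theorem posSemidef_of_quadForm_nonneg {ρ : Matrix ι ι ℂ} (hρ : ρ.IsHermitian)
    (h : ∀ x, 0 ≤ quadForm ρ x) : ρ.PosSemidef := by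
  refine .of_dotProduct_mulVec_nonneg hρ fun x => ?_
  rw [Complex.nonneg_iff]
  exact ⟨h x, (hρ.im_star_dotProduct_mulVec_self x).symm⟩

theorem quadForm_smul (ρ : Matrix ι ι ℂ) (r : ℝ) (x : ι → ℂ) :
    quadForm ρ ((r : ℂ) • x) = r ^ 2 * quadForm ρ x := by
  simp only [quadForm, star_smul, mulVec_smul, smul_dotProduct, dotProduct_smul, smul_eq_mul]
  simp
  ring

theorem quadForm_conjTranspose_mul_mul (V ρ : Matrix ι ι ℂ) (x : ι → ℂ) :
    quadForm (Vᴴ * ρ * V) x = quadForm ρ (V *ᵥ x) := by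
  simp only [quadForm, star_mulVec, ← mulVec_mulVec, dotProduct_mulVec, vecMul_vecMul]

theorem continuous_quadForm (ρ : Matrix ι ι ℂ) : Continuous (quadForm ρ) := by
  unfold quadForm
  fun_prop

end QuadForm

theorem quadForm_fin_two (a b : ℝ) (c : ℂ) (x : Fin 2 → ℂ) :
    quadForm !![(a : ℂ), c; star c, (b : ℂ)] x =
      a * ((x 0).re ^ 2 + (x 0).im ^ 2) + b * ((x 1).re ^ 2 + (x 1).im ^ 2) +
      2 * (c.re * ((x 0).re * (x 1).re + (x 0).im * (x 1).im) +
        c.im * ((x 0).im * (x 1).re - (x 0).re * (x 1).im)) := by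
  simp [quadForm, dotProduct, mulVec, Fin.sum_univ_two]
  ring

theorem quadForm_one_fin_two (x : Fin 2 → ℂ) :
    quadForm 1 x = (x 0).re ^ 2 + (x 0).im ^ 2 + ((x 1).re ^ 2 + (x 1).im ^ 2) := by
  simp [quadForm, dotProduct, Fin.sum_univ_two]
  ring

theorem Density.exists_eq (ρ : Density 2) :
    ∃ (a : ℝ) (c : ℂ), 0 ≤ a ∧ a ≤ 1 ∧ ρ.1 = !![(a : ℂ), c; star c, ((1 - a : ℝ) : ℂ)] := by
  obtain ⟨ρ, hρ, htr⟩ := ρ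
  have h0 := Complex.nonneg_iff.1 (hρ.diag_nonneg (i := 0))
  have h1 := Complex.nonneg_iff.1 (hρ.diag_nonneg (i := 1))
  have h00 : ρ 0 0 = ((ρ 0 0).re : ℂ) := Complex.ext rfl (by simpa using h0.2.symm)
  have h10 : ρ 1 0 = star (ρ 0 1) := (hρ.isHermitian.apply 1 0).symm
  rw [trace_fin_two] at htr
  have hre : (ρ 0 0).re + (ρ 1 1).re = 1 := by simpa using congrArg Complex.re htr
  refine ⟨(ρ 0 0).re, ρ 0 1, h0.1, by linarith [h1.1], ?_⟩
  ext i j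
  fin_cases i <;> fin_cases j
  · exact h00
  · rfl
  · exact h10
  · change ρ 1 1 = _
    rw [eq_sub_of_add_eq' htr, h00]
    simp

/-- Two Hermitian forms in two variables which agree everywhere have the same matrix. -/
theorem Density.ext_quadForm {ρ σ : Density 2} (h : ∀ x, quadForm ρ.1 x = quadForm σ.1 x) :
    ρ = σ := by
  obtain ⟨a, c, -, -, hρ⟩ := ρ.exists_eq
  obtain ⟨b, d, -, -, hσ⟩ := σ.exists_eq
  apply Subtype.ext
  simp only [hρ, hσ, quadForm_fin_two] at h ⊢
  have h0 := h ![1, 0]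
  have h1 := h ![1, 1]
  have h2 := h ![1, Complex.I]
  simp at h0 h1 h2
  have hc : c = d := Complex.ext (by linarith) (by linarith)
  rw [h0, hc]

/-! ### Lower bound for the cost -/

/-- The cost of a two-qubit operator for `C^Q`. -/
theorem swapCost_two_mul_trace_re (R : Matrix (Fin 2 × Fin 2) (Fin 2 × Fin 2) ℂ) :
    (swapCost 2 * R).trace.re =
      ((R (0, 1) (0, 1)).re + (R (1, 0) (1, 0)).re - (R (0, 1) (1, 0)).re
        - (R (1, 0) (0, 1)).re) / 2 := by
  rw [swapCost_mul_trace]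
  simp [trace, Fintype.sum_prod_type, Fin.sum_univ_two]
  ring

theorem sq_sub_sqrt_le_of_mem_costs {ρA ρB : Density 2} {L : ℝ}
    (hL : L ∈ costs (swapCost 2) ρA ρB) :
    (√(ρA.1 0 0).re - √(ρB.1 0 0).re) ^ 2 / 2 ≤ L := by
  obtain ⟨R, ⟨⟨hR, -⟩, hA, hB⟩, rfl⟩ := hL
  dsimp only
  rw [swapCost_two_mul_trace_re]
  set p := (R (0, 1) (0, 1)).re with hp
  set q := (R (1, 0) (1, 0)).re with hq
  set s := (R (0, 0) (0, 0)).re with hs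
  set r := (R (0, 1) (1, 0)).re with hr
  have hr' : (R (1, 0) (0, 1)).re = r := by
    rw [← hR.isHermitian.apply (1, 0) (0, 1)]; simp [hr]
  have ha : (ρA.1 0 0).re = s + p := by
    rw [← hA]; simp [trB, Fin.sum_univ_two, hs, hp]
  have hb : (ρB.1 0 0).re = s + q := by
    rw [← hB]; simp [trA, Fin.sum_univ_two, hs, hq]
  have hs0 : 0 ≤ s := (Complex.nonneg_iff.1 (hR.diag_nonneg (i := (0, 0)))).1
  have hp0 : 0 ≤ p := (Complex.nonneg_iff.1 (hR.diag_nonneg (i := (0, 1)))).1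
  have hq0 : 0 ≤ q := (Complex.nonneg_iff.1 (hR.diag_nonneg (i := (1, 0)))).1
  -- Positivity on the span of `e₀ ⊗ e₁` and `e₁ ⊗ e₀` gives `r² ≤ pq`, through the discriminant.
  have hform : ∀ α : ℝ, 0 ≤ p * (α * α) + (2 * r) * α + q := by
    intro α
    have h := quadForm_nonneg hR fun i => if i = (0, 1) then (α : ℂ) else if i = (1, 0) then 1 else 0
    simp [quadForm, dotProduct, mulVec, Fintype.sum_prod_type, Fin.sum_univ_two, hr', ← hp, ← hq,
      ← hr] at h
    linarith
  have hdisc := discrim_le_zero hform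
  rw [discrim] at hdisc
  have hrpq : r ≤ √(p * q) := Real.le_sqrt_of_sq_le (by linarith)
  have hpq := Real.sq_sqrt (mul_nonneg hp0 hq0)
  -- Cauchy–Schwarz for `(√s, √p)` and `(√s, √q)`; it is an equality when `s = 0`, as in the
  -- coupling of `mem_costs_of_posSemidef`.
  have hle : s + √(p * q) ≤ √(s + p) * √(s + q) := by
    rw [← Real.sqrt_mul (by positivity)]
    refine Real.le_sqrt_of_sq_le ?_
    have hamgm : 2 * √(p * q) ≤ p + q := by
      rw [Real.sqrt_mul hp0]
      nlinarith [sq_nonneg (√p - √q), Real.sq_sqrt hp0, Real.sq_sqrt hq0]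
    nlinarith
  rw [ha, hb, hr', sub_sq, Real.sq_sqrt (by positivity), Real.sq_sqrt (by positivity)]
  linarith

/-! ### Couplings that attain the bound -/

theorem product_mem_costs (ρA ρB : Density 2) :
    (1 - (ρA.1 * ρB.1).trace.re) / 2 ∈ costs (swapCost 2) ρA ρB := by
  obtain ⟨a, c, -, -, hρA⟩ := ρA.exists_eq
  obtain ⟨b, d, -, -, hρB⟩ := ρB.exists_eq
  refine ⟨ρA.1 ⊗ₖ ρB.1, ⟨⟨ρA.2.1.kronecker ρB.2.1, ?_⟩, ?_, ?_⟩, ?_⟩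
  · rw [trace_kronecker, ρA.2.2, ρB.2.2, one_mul]
  · ext i j
    have h := ρB.2.2
    rw [trace_fin_two] at h
    simp [trB, Fin.sum_univ_two, ← mul_add, h]
  · ext i j
    have h := ρA.2.2
    rw [trace_fin_two] at h
    simp [trA, Fin.sum_univ_two, ← add_mul, h]
  · dsimp only
    rw [swapCost_two_mul_trace_re, hρA, hρB]
    simp [trace_fin_two]
    ring

/-- In an eigenbasis, the classical coupling `∑ λᵢ |eᵢ ⊗ eᵢ⟩⟨eᵢ ⊗ eᵢ|` lives on symmetric tensors.
-/
theorem zero_mem_costs_self (ρ : Density 2) : 0 ∈ costs (swapCost 2) ρ ρ := by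
  have hH := ρ.2.1.isHermitian
  let V : Matrix (Fin 2) (Fin 2) ℂ := hH.eigenvectorUnitary
  have hV : Vᴴ * V = 1 := Unitary.coe_star_mul_self hH.eigenvectorUnitary
  have hV' : Vᴴᴴ * Vᴴ = 1 := by rw [conjTranspose_conjTranspose, mul_eq_one_comm.1 hV]
  have hdiag : (ρ.conj hV').1 = diagonal fun i => (hH.eigenvalues i : ℂ) := by
    have h := hH.conjStarAlgAut_star_eigenvectorUnitary
    rw [Unitary.conjStarAlgAut_apply] at h
    rw [Unitary.coe_star, star_star] at h
    change Vᴴ * ρ.1 * Vᴴᴴ = _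
    rw [conjTranspose_conjTranspose]
    exact h
  rw [← costs_conj ρ ρ hV']
  set σ := ρ.conj hV'
  have htr := σ.2.2
  have hev := ρ.2.1.eigenvalues_nonneg
  rw [hdiag, trace_fin_two] at htr
  simp only [diagonal_apply_eq] at htr
  refine ⟨diagonal fun i => if i.1 = i.2 then (hH.eigenvalues i.1 : ℂ) else 0,
    ⟨⟨.diagonal ?_, ?_⟩, ?_, ?_⟩, ?_⟩
  · intro i
    dsimp only
    split_ifs
    · exact Complex.zero_le_real.2 (hev _)
    · exact le_rfl
  · simpa [trace, Fintype.sum_prod_type, Fin.sum_univ_two] using htr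
  · rw [hdiag]
    ext i j
    fin_cases i <;> fin_cases j <;> simp [trB, diagonal_apply]
  · rw [hdiag]
    ext i j
    fin_cases i <;> fin_cases j <;> simp [trA, diagonal_apply]
  · dsimp only
    rw [swapCost_two_mul_trace_re]
    simp

/-- The coupling supported on the span of `e₀ ⊗ e₁ + t e₁ ⊗ e₀` and `e₁ ⊗ e₁`. -/
theorem mem_costs_of_posSemidef {ρA ρB : Density 2} {a t : ℝ} {c : ℂ}
    (hA : ρA.1 = !![(a : ℂ), c; star c, ((1 - a : ℝ) : ℂ)])
    (hB : ρB.1 = !![((t ^ 2 * a : ℝ) : ℂ), t * c; star (t * c), ((1 - t ^ 2 * a : ℝ) : ℂ)])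
    (hM : (!![(a : ℂ), c; star c, ((1 - a - t ^ 2 * a : ℝ) : ℂ)]).PosSemidef) :
    a * (1 - t) ^ 2 / 2 ∈ costs (swapCost 2) ρA ρB := by
  let W : Matrix (Fin 2 × Fin 2) (Fin 2) ℂ := of fun p =>
    !![![0, 0], ![1, 0]; ![(t : ℂ), 0], ![0, 1]] p.1 p.2
  refine ⟨W * !![(a : ℂ), c; star c, ((1 - a - t ^ 2 * a : ℝ) : ℂ)] * Wᴴ,
    ⟨⟨hM.mul_mul_conjTranspose_same W, ?_⟩, ?_, ?_⟩, ?_⟩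
  · simp [trace, Fintype.sum_prod_type, Fin.sum_univ_two, mul_apply, W]
    ring
  · rw [hA]
    ext i j
    fin_cases i <;> fin_cases j <;> simp [trB, Fin.sum_univ_two, mul_apply, W]
    ring
  · rw [hB]
    ext i j
    fin_cases i <;> fin_cases j <;> simp [trA, Fin.sum_univ_two, mul_apply, W] <;> ring
  · dsimp only
    rw [swapCost_two_mul_trace_re]
    simp [mul_apply, Fin.sum_univ_two, W]
    ring

/-- AM–GM, `2√(PQ) ≤ tP + Q/t`, with equality at `√Q = t√P`. It replaces the square roots by an
expression linear in the two forms. -/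
theorem weighted_le_sq_sub_sqrt {P Q t : ℝ} (hP : 0 ≤ P) (hQ : 0 ≤ Q) (ht : 0 < t) :
    (1 - t) * P + (1 - t⁻¹) * Q ≤ (√P - √Q) ^ 2 := by
  have hs : √t * (√t)⁻¹ = 1 := mul_inv_cancel₀ (Real.sqrt_pos.2 ht).ne'
  have h := sq_nonneg (√t * √P - (√t)⁻¹ * √Q)
  have he : (√t * √P - (√t)⁻¹ * √Q) ^ 2 =
      √t ^ 2 * √P ^ 2 - 2 * (√t * (√t)⁻¹) * √P * √Q + (√t ^ 2)⁻¹ * √Q ^ 2 := by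
    rw [← inv_pow]; ring
  rw [he, hs, Real.sq_sqrt ht.le, Real.sq_sqrt hP, Real.sq_sqrt hQ] at h
  rw [sub_sq, Real.sq_sqrt hP, Real.sq_sqrt hQ]
  linarith

/-- A vector at which `u ↦ |√⟨u, ρA u⟩ - √⟨u, ρB u⟩|` is maximal yields a coupling. -/
theorem mem_costs_of_isMax {ρA ρB : Density 2}
    (h : ∀ x, (√(quadForm ρA.1 x) - √(quadForm ρB.1 x)) ^ 2 ≤
      (√(ρA.1 0 0).re - √(ρB.1 0 0).re) ^ 2 * quadForm 1 x) :
    (√(ρA.1 0 0).re - √(ρB.1 0 0).re) ^ 2 / 2 ∈ costs (swapCost 2) ρA ρB := by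
  obtain ⟨a, c, ha, -, hA⟩ := ρA.exists_eq
  obtain ⟨b, d, hb, -, hB⟩ := ρB.exists_eq
  have hqA := quadForm_nonneg ρA.2.1
  have hqB := quadForm_nonneg ρB.2.1
  have ha' : (ρA.1 0 0).re = a := by rw [hA]; simp
  have hb' : (ρB.1 0 0).re = b := by rw [hB]; simp
  rw [ha', hb'] at h ⊢
  have hdet : ∀ (ρ : Density 2) (e : ℂ), ρ.1 = !![((0 : ℝ) : ℂ), e; star e, ((1 - 0 : ℝ) : ℂ)] →
      e = 0 := by
    intro ρ e he
    have h0 := ρ.2.1.det_nonneg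
    rw [he, det_fin_two_of, Complex.nonneg_iff] at h0
    have h1 := h0.1
    simp at h1
    exact Complex.ext (by simp; nlinarith) (by simp; nlinarith)
  -- A vanishing `(0,0)` entry makes that state the pure state `e₁`, and the product coupling has
  -- the required cost.
  rcases eq_or_lt_of_le ha with rfl | ha0
  · obtain rfl := hdet ρA c hA
    convert product_mem_costs ρA ρB using 1
    rw [hA, hB]
    simp [trace_fin_two, Real.sq_sqrt hb]
  rcases eq_or_lt_of_le hb with rfl | hb0
  · obtain rfl := hdet ρB d hB
    convert product_mem_costs ρA ρB using 1
    rw [hA, hB]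
    simp [trace_fin_two, Real.sq_sqrt ha]
  obtain ⟨t, ht, hbt⟩ : ∃ t : ℝ, 0 < t ∧ √b = t * √a :=
    ⟨√b / √a, by positivity, by field_simp⟩
  have hbt2 : b = t ^ 2 * a := by
    rw [← Real.sq_sqrt hb, hbt, mul_pow, Real.sq_sqrt ha]
  have hm : (√a - √b) ^ 2 = a * (1 - t) ^ 2 := by
    rw [hbt, ← one_sub_mul, mul_pow, Real.sq_sqrt ha]; ring
  rw [hm] at h ⊢
  by_cases ht1 : t = 1
  · have hAB : ρA = ρB := by
      refine Density.ext_quadForm fun x => (Real.sqrt_inj (hqA x) (hqB x)).1 ?_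
      have := h x
      rw [ht1] at this
      nlinarith
    rw [hAB, ht1]
    simpa using zero_mem_costs_self ρB
  -- Weight `t` is tight at `e₀`, so its first variation there gives `d = t * c`; weight `t⁻¹` later
  -- gives the positivity.
  have hdual := fun x => (weighted_le_sq_sub_sqrt (hqA x) (hqB x) ht).trans (h x)
  have hdual' := fun x =>
    (weighted_le_sq_sub_sqrt (hqA x) (hqB x) (inv_pos.2 ht)).trans (h x)
  subst hbt2
  simp only [hA, hB, quadForm_fin_two, quadForm_one_fin_two, inv_inv] at hdual hdual'
  have hd : d = t * c := by
    by_contra hne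
    set L := d - t * c with hL
    set k := 1 - t⁻¹ with hk
    set K := (1 - t) * (1 - a) + k * (1 - t ^ 2 * a) - a * (1 - t) ^ 2 with hK
    have hk0 : k ≠ 0 := by
      rw [hk, sub_ne_zero]
      exact fun h1 => ht1 (inv_eq_one.1 h1.symm)
    have hN : 0 < L.re ^ 2 + L.im ^ 2 := by
      have := Complex.normSq_pos.2 (sub_ne_zero.2 hne)
      rw [Complex.normSq_apply] at this
      linarith
    have hLre : L.re = d.re - t * c.re := by simp [hL]
    have hLim : L.im = d.im - t * c.im := by simp [hL]
    -- Perturb `e₀` in the direction `star L`: the constant terms cancel, and a nonzero linear term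
    -- contradicts maximality.
    have hquad : ∀ ε : ℝ, (L.re ^ 2 + L.im ^ 2) * (2 * k * ε + K * ε ^ 2) ≤ 0 := by
      intro ε
      have h0 := hdual ![1, ε * star L]
      simp at h0
      have hkt : k * t = t - 1 := by rw [hk]; field_simp
      have e1 : (1 - t) * a + k * (t ^ 2 * a) = a * (1 - t) ^ 2 := by
        linear_combination t * a * hkt
      have e2 : (1 - t) * c.re + k * d.re = k * L.re := by
        rw [hLre]; linear_combination c.re * hkt
      have e3 : (1 - t) * c.im + k * d.im = k * L.im := by
        rw [hLim]; linear_combination c.im * hkt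
      rw [hK]
      linear_combination h0 - e1 - 2 * ε * L.re * e2 - 2 * ε * L.im * e3
    -- This `ε` has the sign of `k` and is small enough for the linear term to dominate.
    have hδ := hquad (k / (1 + |K|))
    have hK1 : 0 < 1 + |K| := by positivity
    have hexp : 2 * k * (k / (1 + |K|)) + K * (k / (1 + |K|)) ^ 2 =
        k ^ 2 / (1 + |K|) ^ 2 * (2 + 2 * |K| + K) := by
      field_simp
    have hpos : 0 < 2 * k * (k / (1 + |K|)) + K * (k / (1 + |K|)) ^ 2 := by
      rw [hexp]
      have := neg_abs_le K
      have : 0 < 2 + 2 * |K| + K := by linarith [abs_nonneg K]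
      positivity
    exact absurd hδ (not_le.2 (mul_pos hN hpos))
  subst hd
  refine mem_costs_of_posSemidef hA hB (posSemidef_of_quadForm_nonneg ?_ fun x => ?_)
  · ext i j
    fin_cases i <;> fin_cases j <;> simp
  -- After rescaling the first coordinate by `1 / (t + 1)`, the slack in the weight-`t⁻¹` inequality
  -- is exactly `(1 - t)² / t` times the form to be bounded.
  · have h0 := hdual' ![x 0 / ((t + 1 : ℝ) : ℂ), x 1]
    have ht2 : 0 < t + 1 := by linarith
    have hsq : 0 < (1 - t) ^ 2 / t := by
      have : 1 - t ≠ 0 := fun h1 => ht1 (by linarith)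
      positivity
    rw [quadForm_fin_two]
    refine nonneg_of_mul_nonneg_right (le_of_le_of_eq (sub_nonneg.2 h0) ?_) hsq
    simp only [cons_val_zero, cons_val_one, Complex.div_ofReal_re, Complex.div_ofReal_im,
      Complex.re_ofReal_mul, Complex.im_ofReal_mul]
    field_simp
    ring

/-- Compactness of the unit sphere gives `u`; homogeneity extends the bound to all `x`. -/
theorem exists_isMax_sq_sub_sqrt_quadForm (ρA ρB : Matrix (Fin 2) (Fin 2) ℂ) :
    ∃ u, quadForm 1 u = 1 ∧ ∀ x, (√(quadForm ρA x) - √(quadForm ρB x)) ^ 2 ≤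
      (√(quadForm ρA u) - √(quadForm ρB u)) ^ 2 * quadForm 1 x := by
  have hcompact : IsCompact {x : Fin 2 → ℂ | quadForm 1 x = 1} := by
    refine Metric.isCompact_of_isClosed_isBounded
      (isClosed_eq (continuous_quadForm 1) continuous_const) ?_
    refine (Metric.isBounded_closedBall (x := (0 : Fin 2 → ℂ)) (r := 1)).subset fun x hx => ?_
    rw [mem_closedBall_zero_iff, pi_norm_le_iff_of_nonneg zero_le_one]
    intro i
    rw [Set.mem_ofPred_eq, quadForm_one_fin_two] at hx
    rw [← sq_le_one_iff₀ (norm_nonneg _), Complex.sq_norm, Complex.normSq_apply]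
    fin_cases i <;> simp only [Fin.zero_eta, Fin.mk_one] <;> nlinarith
  have hcont : Continuous fun x => (√(quadForm ρA x) - √(quadForm ρB x)) ^ 2 :=
    (((continuous_quadForm ρA).sqrt).sub ((continuous_quadForm ρB).sqrt)).pow 2
  obtain ⟨u, hu, hmax⟩ := hcompact.exists_isMaxOn
    ⟨![1, 0], by simp [quadForm_one_fin_two]⟩ hcont.continuousOn
  refine ⟨u, hu, fun x => ?_⟩
  rcases eq_or_lt_of_le (quadForm_nonneg .one x) with h0 | hpos
  · have hx : x = 0 := by
      rw [quadForm_one_fin_two] at h0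
      funext i
      fin_cases i <;> apply Complex.ext <;> simp <;> nlinarith
    simp [hx, quadForm]
  · set N := quadForm 1 x
    have hx : ∀ ρ, quadForm ρ x = N * quadForm ρ ((((√N)⁻¹ : ℝ) : ℂ) • x) := by
      intro ρ
      rw [quadForm_smul, inv_pow, Real.sq_sqrt hpos.le, mul_inv_cancel_left₀ hpos.ne']
    have hle := hmax (mul_left_cancel₀ hpos.ne' ((hx 1).symm.trans (mul_one N).symm))
    rw [hx ρA, hx ρB, Real.sqrt_mul hpos.le, Real.sqrt_mul hpos.le, ← mul_sub, mul_pow,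
      Real.sq_sqrt hpos.le, mul_comm]
    exact mul_le_mul_of_nonneg_right hle hpos.le

/-- The transport cost of qubits is half the greatest value of `(√⟨u, ρA u⟩ - √⟨u, ρB u⟩)²`. -/
theorem exists_isLeast_costs (ρA ρB : Density 2) :
    ∃ u, quadForm 1 u = 1 ∧ IsLeast (costs (swapCost 2) ρA ρB)
        ((√(quadForm ρA.1 u) - √(quadForm ρB.1 u)) ^ 2 / 2) ∧
      ∀ x, (√(quadForm ρA.1 x) - √(quadForm ρB.1 x)) ^ 2 ≤
        (√(quadForm ρA.1 u) - √(quadForm ρB.1 u)) ^ 2 * quadForm 1 x := by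
  obtain ⟨u, hu, hmax⟩ := exists_isMax_sq_sub_sqrt_quadForm ρA.1 ρB.1
  refine ⟨u, hu, ?_, hmax⟩
  -- A unitary with first column `u`; conjugating by `Vᴴ` moves `u` to `e₀`.
  let V : Matrix (Fin 2) (Fin 2) ℂ := !![u 0, -star (u 1); u 1, star (u 0)]
  have hV : Vᴴ * V = 1 := by
    rw [quadForm_one_fin_two] at hu
    ext i j
    fin_cases i <;> fin_cases j <;> apply Complex.ext <;>
      simp [V, mul_apply, Fin.sum_univ_two] <;> linarith
  have hV' : Vᴴᴴ * Vᴴ = 1 := by rw [conjTranspose_conjTranspose, mul_eq_one_comm.1 hV]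
  have hq : ∀ (ρ : Density 2) x, quadForm (ρ.conj hV').1 x = quadForm ρ.1 (V *ᵥ x) := by
    intro ρ x
    rw [← quadForm_conjTranspose_mul_mul]
    simp [Density.conj]
  have hVu : V *ᵥ ![1, 0] = u := by
    funext i
    fin_cases i <;> simp [V, mulVec, dotProduct]
  have h00 : ∀ ρ : Density 2, ((ρ.conj hV').1 0 0).re = quadForm ρ.1 u := by
    intro ρ
    rw [← hVu, ← hq]
    simp [quadForm, dotProduct, mulVec, Fin.sum_univ_two]
  have hone : ∀ x, quadForm 1 (V *ᵥ x) = quadForm 1 x := by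
    intro x
    rw [← quadForm_conjTranspose_mul_mul, mul_one, hV]
  rw [← costs_conj ρA ρB hV', ← h00 ρA, ← h00 ρB]
  refine ⟨mem_costs_of_isMax fun x => ?_, fun L hL => sq_sub_sqrt_le_of_mem_costs hL⟩
  rw [hq, hq, h00, h00, ← hone x]
  exact hmax _

/-! ### The metric properties -/

theorem isLeast_transport (ρA ρB : Density 2) :
    IsLeast (costs (swapCost 2) ρA ρB) (transport (swapCost 2) ρA ρB) := by
  obtain ⟨u, -, hu, -⟩ := exists_isLeast_costs ρA ρB
  rwa [transport, hu.csInf_eq]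

theorem exists_sqrtTransport_eq (ρA ρB : Density 2) :
    ∃ u, quadForm 1 u = 1 ∧
      sqrtTransport (swapCost 2) ρA ρB = |√(quadForm ρA.1 u) - √(quadForm ρB.1 u)| / √2 ∧
      ∀ x, quadForm 1 x = 1 →
        |√(quadForm ρA.1 x) - √(quadForm ρB.1 x)| / √2 ≤ sqrtTransport (swapCost 2) ρA ρB := by
  obtain ⟨u, hu, hleast, hmax⟩ := exists_isLeast_costs ρA ρB
  have heq : sqrtTransport (swapCost 2) ρA ρB =
      |√(quadForm ρA.1 u) - √(quadForm ρB.1 u)| / √2 := by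
    rw [sqrtTransport, transport, hleast.csInf_eq, Real.sqrt_div (sq_nonneg _), Real.sqrt_sq_eq_abs]
  refine ⟨u, hu, heq, fun x hx => ?_⟩
  rw [heq]
  have h := hmax x
  rw [hx, mul_one, sq_le_sq] at h
  gcongr

theorem isMetric_sqrtTransport : IsMetric (sqrtTransport (swapCost 2)) := by
  have hsymm : ∀ ρA ρB : Density 2,
      sqrtTransport (swapCost 2) ρA ρB ≤ sqrtTransport (swapCost 2) ρB ρA := by
    intro ρA ρB
    obtain ⟨u, hu, heq, -⟩ := exists_sqrtTransport_eq ρA ρB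
    obtain ⟨-, -, -, hle⟩ := exists_sqrtTransport_eq ρB ρA
    rw [heq, abs_sub_comm]
    exact hle u hu
  refine ⟨fun _ _ => Real.sqrt_nonneg _, fun ρA ρB => ⟨fun h => ?_, ?_⟩,
    fun ρA ρB => le_antisymm (hsymm ρA ρB) (hsymm ρB ρA), fun ρA ρB ρC => ?_⟩
  · obtain ⟨u, -, hleast, hmax⟩ := exists_isLeast_costs ρA ρB
    rw [sqrtTransport, transport, hleast.csInf_eq, Real.sqrt_eq_zero (by positivity)] at h
    have hu : (√(quadForm ρA.1 u) - √(quadForm ρB.1 u)) ^ 2 = 0 := by linarith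
    refine Density.ext_quadForm fun x => ?_
    have hx := hmax x
    rw [hu, zero_mul] at hx
    have hx0 := pow_eq_zero_iff two_ne_zero |>.1 (le_antisymm hx (sq_nonneg _))
    exact (Real.sqrt_inj (quadForm_nonneg ρA.2.1 x) (quadForm_nonneg ρB.2.1 x)).1
      (sub_eq_zero.1 hx0)
  · rintro rfl
    obtain ⟨u, -, heq, -⟩ := exists_sqrtTransport_eq ρA ρA
    simpa using heq
  · obtain ⟨u, hu, heq, -⟩ := exists_sqrtTransport_eq ρA ρC
    obtain ⟨-, -, -, hAB⟩ := exists_sqrtTransport_eq ρA ρB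
    obtain ⟨-, -, -, hBC⟩ := exists_sqrtTransport_eq ρB ρC
    rw [heq]
    refine le_trans ?_ (add_le_add (hAB u hu) (hBC u hu))
    rw [← add_div]
    gcongr
    exact abs_sub_le _ _ _

end QOT

theorem corollary7p3 :
    -- `T^Q_{C^Q}` is an attained, nonnegative minimum on `Ω_2`
    (∀ ρA ρB : QOT.Density 2,
      IsLeast (QOT.costs (QOT.swapCost 2) ρA ρB) (QOT.transport (QOT.swapCost 2) ρA ρB) ∧
      0 ≤ QOT.transport (QOT.swapCost 2) ρA ρB) ∧
    -- its square root is a metric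
    QOT.IsMetric (QOT.sqrtTransport (QOT.swapCost 2)) ∧
    -- the Wasserstein-2 distance for `C^Q` is defined, and it is this square root
    (QOT.swapCost 2).PosSemidef ∧ QOT.VanishesExactlyOnSymmetric (QOT.swapCost 2) ∧
    (∀ ρA ρB : QOT.Density 2,
      (∀ N : ℕ, IsLeast (QOT.chainLengths (QOT.sqrtTransport (QOT.swapCost 2)) N ρA ρB)
        (QOT.chainDist (QOT.sqrtTransport (QOT.swapCost 2)) N ρA ρB)) ∧
      Filter.Tendsto (fun N => QOT.chainDist (QOT.sqrtTransport (QOT.swapCost 2)) N ρA ρB)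
        Filter.atTop (nhds (QOT.wasserstein (QOT.swapCost 2) ρA ρB)) ∧
      QOT.wasserstein (QOT.swapCost 2) ρA ρB = QOT.sqrtTransport (QOT.swapCost 2) ρA ρB) := by
  have hD := QOT.isMetric_sqrtTransport
  refine ⟨fun ρA ρB => ?_, hD, QOT.swapCost_posSemidef, QOT.swapCost_vanishesExactlyOnSymmetric,
    fun ρA ρB => ⟨fun N => ?_, ?_, hD.inducedDist_eq ρA ρB⟩⟩
  · obtain ⟨u, -, hleast, -⟩ := QOT.exists_isLeast_costs ρA ρB
    refine ⟨QOT.isLeast_transport ρA ρB, ?_⟩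
    rw [QOT.transport, hleast.csInf_eq]
    positivity
  · rw [hD.chainDist_eq]
    exact hD.isLeast_chainLengths N ρA ρB
  · rw [QOT.wasserstein, hD.inducedDist_eq]
    simp only [hD.chainDist_eq]
    exact tendsto_const_nhds
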